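/- **Setting.** Let $D$ be a probability distribution of an individual $(x,s,y)\in\mathbb R^p\times\mathbb R\times\{-1,1\}$ with $\|x\|=1$ almost surely, and let $h_*\in\mathbb R^p$ satisfy $\operatorname{cov}(\langle h_*,x\rangle,s)=0$. Let $(x_i,s_i,y_i)_{i=1}^n$ be i.i.d. from $D$ and, independently of them, let $h_{r_1},\dots,h_{r_k}$ be i.i.d. from $\mathcal N(h_*,I)$ (the hypotheses returned under the soft threshold policy), where $k+1\le n$. Let $f=\sum_{t=1}^k\alpha_t h_{r_t}$, where the coefficients $\alpha$ are produced from the sample and the hypotheses by an arbitrary measurable training rule; the linear model $f$ predicts $\operatorname{sign}\langle f,x\rangle$. Write $er(f)=\Pr_D\{\operatorname{sign}\langle f,x\rangle\ne y\}$ and $\hat{er}(f)=\frac1n\#\{i:\operatorname{sign}\langle f,x_i\rangle\neq y_i\}$. For $0<\delta<1$ put $$T=2\sqrt{\frac{(k+1)\log\frac{en}{k+1}+\log\frac1\delta}{n}},\qquad P=\frac{4}{n\delta}\sum_{i=1}^n g(x_i)\,e^{-\frac{k\langle f,x_i\rangle^2}{8(2+|\langle f,x_i\rangle|)^2}},$$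 $$g(x_i)=e^{\frac{c_ik\langle h_*,x_i\rangle^2}{4-2c_i}}+e^{-\frac{c_ik\langle h_*,x_i\rangle^2}{2+2c_i}},\qquad c_i=\frac{|\langle f,x_i\rangle|}{2+|\langle f,x_i\rangle|},$$ and $Q_i=\left(\langle h_*,x_i\rangle^2-\tfrac14\right)\left(|\langle f,x_i\rangle|+2\right)^2+1$. **Claim.** For every $\delta\in(0,1)$ there are positive constants $c_1,c_2,C$ depending only on $\delta$, and for every $\varepsilon>0$ a positive constant $r(\varepsilon)$ depending only on $\delta$ and $\varepsilon$, such that the following holds. (1) For all $p$, all $n\ge1$, all $k\ge0$, all $h_*\in\mathbb R^p$ and all unit vectors $f,x_1,\dots,x_n\in\mathbb R^p$: $T\le c_1$ (the square root of a negative number being read as $0$, which can only occur when $k+1>n$); if $Q_i\le0$ for all $i$, then $T+P\le c_1+Ce^{-c_2k}$; and if $Q_i\le-\varepsilon$ for all $i$, for some $\varepsilon>0$, then $P\le Ce^{-r(\varepsilon)k}$. (2) In the setting above, with probability at least $1-4\delta$, if $\|f\|=1$ then: $er(f)\le\hat{er}(f)+T+P$; if $Q_i\le0$ for all $i$, then $$er(f)\le\hat{er}(f)+c_1+Ce^{-c_2k};$$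 and, for every $\varepsilon>0$, if $Q_i\le-\varepsilon$ for all $i$, then $er(f)\le\hat{er}(f)+T+Ce^{-r(\varepsilon)k}$, that is, the part of the error bound beyond the term $T\le c_1$ decays exponentially in $k$. -/

import Mathlib

open MeasureTheory ProbabilityTheory

noncomputable section

namespace FairLearning

/-- The space `ℝ^p` of non-sensitive feature vectors, with its Euclidean norm. A linear model is
identified with its weight vector, `f(x) = ⟨f, x⟩`. -/
abbrev Feat (p : ℕ) : Type := EuclideanSpace ℝ (Fin p)

/-- An individual `(x, s, y)`: features, sensitive demographic feature, label. -/
abbrev Indiv (p : ℕ) : Type := Feat p × ℝ × ℝ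

/-- Expected (classification) error of the linear model `f`: the probability that the sign of
`⟨f, x⟩` differs from the label `y`. -/
def expErr {p : ℕ} (D : Measure (Indiv p)) (f : Feat p) : ℝ :=
  D.real {z | Real.sign (inner ℝ f z.1) ≠ z.2.2}

open Classical in
/-- Empirical (classification) error of the linear model `f` on a sample of size `n`. -/
def empErr {p n : ℕ} (S : Fin n → Indiv p) (f : Feat p) : ℝ :=
  ((Finset.univ.filter
    fun i : Fin n => Real.sign (inner ℝ f (S i).1) ≠ (S i).2.2).card : ℝ) / n

/-- The joint law of the training sample (`n` i.i.d. individuals from `D`) and of the `k` returned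
hypotheses `h_{r_1}, …, h_{r_k}` under the soft threshold policy: i.i.d. from `N(h⋆, I)`,
independent of the sample. -/
def softLaw {p : ℕ} (D : Measure (Indiv p)) (hs : Feat p) (n k : ℕ) :
    Measure ((Fin n → Indiv p) × (Fin k → Feat p)) :=
  (Measure.pi fun _ : Fin n => D).prod
    (Measure.pi fun _ : Fin k => multivariateGaussian hs (1 : Matrix (Fin p) (Fin p) ℝ))

/-- The model `f = ∑ₜ αₜ h_{r_t}` that the training rule `α` outputs on the training sample `ω.1`
and the returned hypotheses `ω.2`. -/
def model {p n k : ℕ} (α : (Fin n → Indiv p) × (Fin k → Feat p) → Fin k → ℝ)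
    (ω : (Fin n → Indiv p) × (Fin k → Feat p)) : Feat p :=
  ∑ t, α ω t • ω.2 t

/-- `c = |⟨f, x⟩| / (2 + |⟨f, x⟩|)`. -/
def distCoef {p : ℕ} (f x : Feat p) : ℝ :=
  |inner ℝ f x| / (2 + |inner ℝ f x|)

/-- `g(x) = exp(c k ⟨h⋆, x⟩² / (4 - 2c)) + exp(- c k ⟨h⋆, x⟩² / (2 + 2c))`. -/
def distG {p : ℕ} (k : ℕ) (hs f x : Feat p) : ℝ :=
  Real.exp (distCoef f x * k * inner ℝ hs x ^ 2 / (4 - 2 * distCoef f x)) +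
    Real.exp (-(distCoef f x * k * inner ℝ hs x ^ 2 / (2 + 2 * distCoef f x)))

/-- `T = 2 √(((k+1) log(e n / (k+1)) + log(1/δ)) / n)`. -/
def vcTerm (n k : ℕ) (δ : ℝ) : ℝ :=
  2 * Real.sqrt
    ((((k : ℝ) + 1) * Real.log (Real.exp 1 * n / ((k : ℝ) + 1)) + Real.log (1 / δ)) / n)

/-- The projection part of the error bound,
`4/(nδ) ∑ᵢ g(xᵢ) exp(- k ⟨f, xᵢ⟩² / (8 (2 + |⟨f, xᵢ⟩|)²))`. -/
def projTerm {p n : ℕ} (k : ℕ) (δ : ℝ) (hs f : Feat p) (x : Fin n → Feat p) : ℝ :=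
  4 / (n * δ) * ∑ i, distG k hs f (x i) *
    Real.exp (-((k : ℝ) * inner ℝ f (x i) ^ 2 / (8 * (2 + |inner ℝ f (x i)|) ^ 2)))

/-- The quantity `(⟨h⋆, x⟩² - 1/4) (|⟨f, x⟩| + 2)² + 1` whose sign is required to be nonpositive. -/
def decayGap {p : ℕ} (hs f x : Feat p) : ℝ :=
  (inner ℝ hs x ^ 2 - 1 / 4) * (|inner ℝ f x| + 2) ^ 2 + 1

end FairLearning

end

/-! The generalization half is a Vapnik-Chervonenkis bound. The hypotheses are independent of the
sample, so they may be frozen: `f` then ranges over a fixed `k`-dimensional span, and for labels in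
`{-1, 1}` its error set is a closed homogeneous half-space for the features `y⟨h_t, x⟩`. A ghost
sample, random swaps, Sauer's lemma and a Chernoff bound give `er ≤ êr + T` with probability at
least `1 - 2δ` (`one_sub_le_measureReal_expErr_le`). The projection term and the exponentials are
nonnegative, so adding them keeps the bound.

The deterministic half is calculus. `T` is bounded because `d (1 + log (n/d)) ≤ n` (`vcTerm_le`).
With `a = |⟨f, x⟩|`, the growing exponential in `g` and the decaying factor beside it cancel when `Q
= 0` and leave a rate of order `ε²` when `Q ≤ -ε` (`exponent_le_of_decayGap`). -/

namespace FairLearning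

/-! ### Counting: sign sums, binomial sums, half-space patterns. -/

open Finset in
/-- Chernoff bound for Rademacher sums, in counting form. -/
lemma card_signs_sum_gt_le {n : ℕ} (a : Fin n → ℝ) (ha : ∀ i, |a i| ≤ 1) (e : ℝ) (he : 0 ≤ e) :
    (#{σ : Fin n → Bool | n * e < ∑ i, (if σ i then -a i else a i)} : ℝ) ≤
      2 ^ n * Real.exp (-(n * e ^ 2 / 2)) := by
  -- The Chernoff parameter is `e` itself, which minimizes `s²/2 - s e`; the sum over signs factors
  -- into terms `2 cosh (e aᵢ)`.
  have hmgf : ∑ σ : Fin n → Bool, Real.exp (e * ∑ i, (if σ i then -a i else a i)) ≤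
      2 ^ n * Real.exp (n * e ^ 2 / 2) := by
    have h1 : ∀ σ : Fin n → Bool, Real.exp (e * ∑ i, (if σ i then -a i else a i)) =
        ∏ i, Real.exp (e * (if σ i then -a i else a i)) := fun σ => by
      rw [mul_sum, Real.exp_sum]
    simp_rw [h1]
    rw [← Fintype.prod_sum (fun i (b : Bool) => Real.exp (e * (if b then -a i else a i)))]
    calc _ ≤ ∏ i : Fin n, (2 * Real.exp (e ^ 2 / 2)) := by
          refine prod_le_prod (fun i _ => by positivity) fun i _ => ?_
          have h2 := Real.cosh_le_exp_half_sq (e * a i)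
          rw [Real.cosh_eq] at h2
          have h3 : Real.exp ((e * a i) ^ 2 / 2) ≤ Real.exp (e ^ 2 / 2) := by
            have := (sq_le_one_iff_abs_le_one (a i)).2 (ha i)
            rw [Real.exp_le_exp, mul_pow]
            nlinarith [sq_nonneg e]
          simp only [Fintype.sum_bool, if_true, Bool.false_eq_true, if_false, mul_neg]
          linarith
      _ = _ := by
          rw [prod_const, mul_pow, ← Real.exp_nat_mul]
          simp [mul_div_assoc]
  have hM : (#{σ : Fin n → Bool | n * e < ∑ i, (if σ i then -a i else a i)} : ℝ) *
      Real.exp (n * e ^ 2) ≤ 2 ^ n * Real.exp (n * e ^ 2 / 2) := by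
    refine le_trans ?_ hmgf
    rw [← nsmul_eq_mul]
    refine (card_nsmul_le_sum _ (fun σ : Fin n → Bool =>
      Real.exp (e * ∑ i, (if σ i then -a i else a i))) _ fun σ hσ => ?_).trans
      (sum_le_sum_of_subset_of_nonneg (subset_univ _) fun _ _ _ => (Real.exp_pos _).le)
    rw [Real.exp_le_exp]
    have := (mem_filter.1 hσ).2
    nlinarith
  have h4 : Real.exp (n * e ^ 2 / 2) = Real.exp (-(n * e ^ 2 / 2)) * Real.exp (n * e ^ 2) := by
    rw [← Real.exp_add]; ring_nf
  rw [h4, ← mul_assoc] at hM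
  exact le_of_mul_le_mul_right hM (Real.exp_pos _)

/-- The sum of the first binomial coefficients is at most `(e m / d) ^ d`. -/
lemma sum_choose_le_exp_mul_div_pow {m d : ℕ} (hd : 0 < d) (hdm : d ≤ m) :
    (∑ i ∈ Finset.range (d + 1), (m.choose i : ℝ)) ≤ (Real.exp 1 * m / d) ^ d := by
  have hm : 0 < m := hd.trans_le hdm
  have hd' : (0 : ℝ) < d := by exact_mod_cast hd
  have hm' : (0 : ℝ) < m := by exact_mod_cast hm
  have hdm' : (d : ℝ) ≤ m := by exact_mod_cast hdm
  -- This `q` minimizes `exp (q m) / q ^ d`, the bound obtained by weighting each binomial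
  -- coefficient with `q ^ i ≥ q ^ d`.
  set q : ℝ := d / m with hq
  have hq0 : 0 < q := by positivity
  have hq1 : q ≤ 1 := (div_le_one hm').2 hdm'
  have h1 : (∑ i ∈ Finset.range (d + 1), (m.choose i : ℝ)) * q ^ d ≤ (1 + q) ^ m := by
    rw [Finset.sum_mul, add_comm 1 q, add_pow]
    refine le_trans (Finset.sum_le_sum (g := fun i => q ^ i * 1 ^ (m - i) * (m.choose i : ℝ))
      fun i hi => ?_) (Finset.sum_le_sum_of_subset_of_nonneg ?_ fun i _ _ => by positivity)
    · rw [one_pow, mul_one, mul_comm]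
      gcongr ?_ * _
      exact pow_le_pow_of_le_one hq0.le hq1 (Nat.lt_succ_iff.1 (Finset.mem_range.1 hi))
    · exact Finset.range_subset_range.2 (by omega)
  have h2 : (1 + q) ^ m ≤ Real.exp 1 ^ d := by
    calc (1 + q) ^ m ≤ Real.exp q ^ m := by
          gcongr
          linarith [Real.add_one_le_exp q]
      _ = Real.exp 1 ^ d := by
          rw [← Real.exp_nat_mul, ← Real.exp_nat_mul, hq]
          congr 1; field_simp
  have h3 : Real.exp 1 * m / d = Real.exp 1 / q := by rw [hq]; field_simp
  rw [h3, div_pow, le_div_iff₀ (by positivity)]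
  exact h1.trans h2

open Classical Finset in
/-- The subsets of a finite family of points `φ j` of `ℝ^k` that are cut out by closed homogeneous
half-spaces. -/
noncomputable def halfspacePatterns {J : Type*} [Fintype J] {k : ℕ} (φ : J → Fin k → ℝ) : Finset (Finset J) :=
  {A | ∃ a : Fin k → ℝ, ∀ j, j ∈ A ↔ ∑ t, a t * φ j t ≤ 0}

open Finset in
/-- The Vapnik-Chervonenkis dimension of homogeneous half-spaces in `ℝ^k` is at most `k`. -/
lemma card_le_of_shatters_halfspacePatterns {J : Type*} [Fintype J] [DecidableEq J] {k : ℕ}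
    (φ : J → Fin k → ℝ) {s : Finset J} (hs : (halfspacePatterns φ).Shatters s) : #s ≤ k := by
  by_contra! hlt
  have hdep : ¬ LinearIndependent ℝ (fun j : s => φ j) := fun h => by
    have := h.fintype_card_le_finrank
    simp at this
    omega
  -- A positive coefficient is needed because the half-spaces are closed: only outside them is the
  -- linear form strictly signed.
  obtain ⟨c, hc0, hcpos⟩ : ∃ c : s → ℝ, ∑ j, c j • φ j = 0 ∧ ∃ j, 0 < c j := by
    obtain ⟨c, hc, j, hj⟩ := Fintype.not_linearIndependent_iff.1 hdep
    rcases lt_or_gt_of_ne hj with h | h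
    · exact ⟨-c, by simp only [Pi.neg_apply, neg_smul, Finset.sum_neg_distrib, hc, neg_zero], j,
        by simpa using h⟩
    · exact ⟨c, hc, j, h⟩
  -- Cutting out the indices with `c ≤ 0` makes every `c j * ⟨a, φ j⟩` nonnegative and one of them
  -- positive, although they sum to zero.
  obtain ⟨u, hu, hsu⟩ := hs (t := {j ∈ s | ∃ h : j ∈ s, c ⟨j, h⟩ ≤ 0}) (filter_subset _ _)
  obtain ⟨a, ha⟩ : ∃ a : Fin k → ℝ, ∀ j, j ∈ u ↔ ∑ t, a t * φ j t ≤ 0 := by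
    classical exact (mem_filter.1 hu).2
  have hmem : ∀ j : s, c j ≤ 0 ↔ ∑ t, a t * φ j t ≤ 0 := fun j => by
    rw [← ha]
    have := congrArg (fun v => (j : J) ∈ v) hsu
    simp only [mem_inter, coe_mem, true_and, mem_filter, eq_iff_iff] at this
    rw [this]
    simp
  have hzero : ∑ j : s, c j * ∑ t, a t * φ j t = 0 := by
    have h1 : ∀ t, ∑ j : s, c j * φ j t = 0 := fun t => by
      simpa using congrFun hc0 t
    simp_rw [mul_sum]
    rw [sum_comm]
    refine sum_eq_zero fun t _ => ?_
    calc _ = a t * ∑ j : s, c j * φ j t := by rw [mul_sum]; exact sum_congr rfl fun _ _ => by ring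
      _ = 0 := by rw [h1, mul_zero]
  obtain ⟨j₀, hj₀⟩ := hcpos
  refine (sum_pos' (fun j _ => ?_) ⟨j₀, mem_univ _, ?_⟩).ne' hzero
  · rcases le_or_gt (c j) 0 with h | h
    · exact mul_nonneg_of_nonpos_of_nonpos h ((hmem j).1 h)
    · exact mul_nonneg h.le (not_le.1 (mt (hmem j).2 h.not_ge)).le
  · exact mul_pos hj₀ (not_le.1 (mt (hmem j₀).2 hj₀.not_ge))

open Finset in
/-- Sauer's bound for the number of half-space patterns. -/
lemma card_halfspacePatterns_le {J : Type*} [Fintype J] {k d : ℕ} (φ : J → Fin k → ℝ)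
    (hkd : k ≤ d) (hd : 0 < d) (hdJ : d ≤ Fintype.card J) :
    (#(halfspacePatterns φ) : ℝ) ≤ (Real.exp 1 * Fintype.card J / d) ^ d := by
  classical
  have hvc : (halfspacePatterns φ).vcDim ≤ d := Finset.sup_le fun s hs =>
    (card_le_of_shatters_halfspacePatterns φ (mem_shatterer.1 hs)).trans hkd
  refine le_trans ?_ (sum_choose_le_exp_mul_div_pow hd hdJ)
  have h1 := (card_le_card_shatterer (halfspacePatterns φ)).trans card_shatterer_le_sum_vcDim
  have h2 : ∑ i ∈ Iic (halfspacePatterns φ).vcDim, (Fintype.card J).choose i ≤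
      ∑ i ∈ range (d + 1), (Fintype.card J).choose i :=
    sum_le_sum_of_subset fun i hi => mem_range.2 (by have := mem_Iic.1 hi; omega)
  exact_mod_cast h1.trans h2

/-! ### Hoeffding's inequality and symmetrization by swaps. -/

/-- The number of points of the sample `S` that lie in `A`. -/
noncomputable def hits {Z : Type*} {n : ℕ} (A : Set Z) (S : Fin n → Z) : ℝ :=
  ∑ i, A.indicator 1 (S i)

/-- Hoeffding's inequality for the lower tail of an empirical frequency. -/
lemma measure_hits_le {Z : Type*} [MeasurableSpace Z] (D : Measure Z) [IsProbabilityMeasure D]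
    {n : ℕ} {A : Set Z} (hA : MeasurableSet A) {t : ℝ} (ht : 0 ≤ t) :
    (Measure.pi fun _ : Fin n => D).real {S | hits A S ≤ n * D.real A - n * t} ≤
      Real.exp (-(2 * n * t ^ 2)) := by
  rcases Nat.eq_zero_or_pos n with rfl | hn
  · simp
  -- The sign turns the lower tail into an upper one; values in `[-1, 0]` give variance proxy `1/4`.
  set X : Z → ℝ := fun z => -(A.indicator 1 z)
  have hXm : Measurable X := (measurable_const.indicator hA).neg
  have hX : HasSubgaussianMGF (fun z => X z - D[X]) ((‖(0 : ℝ) - (-1)‖₊ / 2) ^ 2) D :=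
    hasSubgaussianMGF_of_mem_Icc hXm.aemeasurable (ae_of_all _ fun z => by
      by_cases hz : z ∈ A <;> simp [X, hz])
  have hmean : D[X] = -D.real A := by
    simp only [X, integral_neg]
    rw [integral_indicator_one hA]
  have hind : iIndepFun (fun (i : Fin n) (S : Fin n → Z) => X (S i) - D[X])
      (Measure.pi fun _ : Fin n => D) :=
    iIndepFun_pi (X := fun _ z => X z - D[X]) fun _ => (hXm.sub_const _).aemeasurable
  have hsub : ∀ i ∈ Finset.univ, HasSubgaussianMGF (fun S : Fin n → Z => X (S i) - D[X])
      ((‖(0 : ℝ) - (-1)‖₊ / 2) ^ 2) (Measure.pi fun _ : Fin n => D) := fun i _ => by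
    refine HasSubgaussianMGF.of_map (Y := fun S : Fin n → Z => S i)
      (X := fun z => X z - D[X]) (measurable_pi_apply i).aemeasurable ?_
    rw [(measurePreserving_eval (fun _ : Fin n => D) i).map_eq]
    exact hX
  have h := HasSubgaussianMGF.measure_sum_ge_le_of_iIndepFun hind hsub
    (ε := n * t) (by positivity)
  have hn' : (0 : ℝ) < n := by exact_mod_cast hn
  convert h using 2
  · ext S
    simp only [Set.mem_ofPred_eq, hits, hmean, X, sub_neg_eq_add, Finset.sum_add_distrib,
      Finset.sum_neg_distrib, Finset.sum_const, Finset.card_univ, Fintype.card_fin, nsmul_eq_mul]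
    constructor <;> intro h <;> linarith
  · simp
    field_simp

/-- Exchange of the two components of those pairs that are selected by `σ`. -/
def swapPairs {Z : Type*} {n : ℕ} (σ : Fin n → Bool) (P : Fin n → Z × Z) : Fin n → Z × Z :=
  fun i => if σ i then (P i).swap else P i

lemma measurePreserving_swapPairs {Z : Type*} [MeasurableSpace Z] (D : Measure Z)
    [IsProbabilityMeasure D] {n : ℕ} (σ : Fin n → Bool) :
    MeasurePreserving (swapPairs (Z := Z) σ) (Measure.pi fun _ : Fin n => D.prod D)
      (Measure.pi fun _ : Fin n => D.prod D) := by
  refine measurePreserving_pi (f := fun i (p : Z × Z) => if σ i then p.swap else p) _ _ fun i => ?_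
  cases σ i
  · exact MeasurePreserving.id (D.prod D)
  · simpa using Measure.measurePreserving_swap (μ := D) (ν := D)

/-- If every point has at most `M` of its `2 ^ n` swaps in `G`, then `G` has measure at most
`M / 2 ^ n`. -/
lemma measureReal_le_of_card_swapPairs_le {Z : Type*} [MeasurableSpace Z] (D : Measure Z)
    [IsProbabilityMeasure D] {n : ℕ} {G : Set (Fin n → Z × Z)} (hG : MeasurableSet G) {M : ℝ}
    (hM : ∀ P, ∑ σ : Fin n → Bool, G.indicator (1 : (Fin n → Z × Z) → ℝ) (swapPairs σ P) ≤ 2 ^ n * M) :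
    (Measure.pi fun _ : Fin n => D.prod D).real G ≤ M := by
  set μ := Measure.pi fun _ : Fin n => D.prod D
  have hint : ∀ σ, Integrable (fun P => G.indicator (1 : (Fin n → Z × Z) → ℝ) (swapPairs σ P)) μ := fun σ =>
    (measurePreserving_swapPairs D σ).integrable_comp_of_integrable
      ((integrable_const (1 : ℝ)).indicator hG)
  -- Swaps preserve the law, so the average over `σ` integrates to the measure of `G`.
  have h1 : ∀ σ, ∫ P, G.indicator (1 : (Fin n → Z × Z) → ℝ) (swapPairs σ P) ∂μ = μ.real G := fun σ => by
    have hmp := measurePreserving_swapPairs D (n := n) σ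
    rw [← integral_indicator_one hG]
    conv_rhs => rw [show μ = μ.map (swapPairs σ) from hmp.map_eq.symm]
    rw [integral_map hmp.measurable.aemeasurable]
    exact ((measurable_const (a := (1 : ℝ))).indicator hG).aestronglyMeasurable
  have h2 : ∫ P, ∑ σ : Fin n → Bool, G.indicator (1 : (Fin n → Z × Z) → ℝ) (swapPairs σ P) ∂μ ≤
      ∫ _, 2 ^ n * M ∂μ :=
    integral_mono (integrable_finsetSum _ fun σ _ => hint σ) (integrable_const _) hM
  rw [integral_finsetSum _ fun σ _ => hint σ] at h2
  simp only [h1, Finset.sum_const, Finset.card_univ, Fintype.card_pi, Fintype.card_bool,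
    Finset.prod_const, Fintype.card_fin, nsmul_eq_mul, integral_const, probReal_univ,
    smul_eq_mul, one_mul, Nat.cast_pow, Nat.cast_ofNat] at h2
  exact le_of_mul_le_mul_left h2 (by positivity)

/-- The pairs of samples on which the set selected by the first sample has been hit by the second
sample more often, by a margin of `n * e`. -/
def ghostGap {Z : Type*} {n : ℕ} (W : (Fin n → Z) → Set Z) (e : ℝ) : Set (Fin n → Z × Z) :=
  {P | n * e < hits (W fun i => (P i).1) (fun i => (P i).2) -
    hits (W fun i => (P i).1) (fun i => (P i).1)}

lemma measurable_hits_select {Z Ω : Type*} [MeasurableSpace Z] [MeasurableSpace Ω] {n : ℕ}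
    {W : Ω → Set Z} (hW : MeasurableSet {p : Ω × Z | p.2 ∈ W p.1})
    {X : Type*} [MeasurableSpace X] {u : X → Ω} (hu : Measurable u) {v : X → Fin n → Z}
    (hv : Measurable v) : Measurable fun x => hits (W (u x)) (v x) := by
  refine Finset.measurable_sum _ fun i _ => ?_
  have h1 : Measurable fun x => (u x, v x i) := by fun_prop
  exact ((measurable_const (a := (1 : ℝ))).indicator hW).comp h1

lemma measurableSet_ghostGap {Z : Type*} [MeasurableSpace Z] {n : ℕ} {W : (Fin n → Z) → Set Z}
    (hW : MeasurableSet {p : (Fin n → Z) × Z | p.2 ∈ W p.1}) (e : ℝ) :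
    MeasurableSet (ghostGap W e) := by
  have h1 : Measurable fun (P : Fin n → Z × Z) i => (P i).1 := by fun_prop
  have h2 : Measurable fun (P : Fin n → Z × Z) i => (P i).2 := by fun_prop
  exact measurableSet_lt measurable_const
    ((measurable_hits_select hW h1 h2).sub (measurable_hits_select hW h1 h1))

lemma measurable_measureReal_select {Z Ω : Type*} [MeasurableSpace Z] [MeasurableSpace Ω]
    (D : Measure Z) [IsProbabilityMeasure D] {W : Ω → Set Z}
    (hW : MeasurableSet {p : Ω × Z | p.2 ∈ W p.1}) : Measurable fun ω => D.real (W ω) :=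
  (measurable_measure_prodMk_left hW).ennreal_toReal

/-- Symmetrization by a ghost sample, for the set `W S` selected by the sample `S`. -/
lemma measureReal_hits_add_lt_le_ghostGap {Z : Type*} [MeasurableSpace Z] (D : Measure Z)
    [IsProbabilityMeasure D] {n : ℕ} {W : (Fin n → Z) → Set Z}
    (hW : MeasurableSet {p : (Fin n → Z) × Z | p.2 ∈ W p.1}) {t e : ℝ} (ht : 0 ≤ t)
    (hnt : Real.exp (-(2 * n * t ^ 2)) ≤ 1 / 2) :
    (Measure.pi fun _ : Fin n => D).real {S | hits (W S) S + n * (e + t) < n * D.real (W S)} ≤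
      2 * (Measure.pi fun _ : Fin n => D.prod D).real (ghostGap W e) := by
  set μ := Measure.pi fun _ : Fin n => D
  set B : Set (Fin n → Z) := {S | hits (W S) S + n * (e + t) < n * D.real (W S)} with hB
  have hBm : MeasurableSet B := measurableSet_lt
    ((measurable_hits_select hW measurable_id measurable_id).add_const _)
    ((measurable_measureReal_select D hW).const_mul _)
  set G' : Set ((Fin n → Z) × (Fin n → Z)) :=
    {q | n * e < hits (W q.1) q.2 - hits (W q.1) q.1} with hG'
  have hG'm : MeasurableSet G' := measurableSet_lt measurable_const
    ((measurable_hits_select hW measurable_fst measurable_snd).sub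
      (measurable_hits_select hW measurable_fst measurable_fst))
  have h1 : (Measure.pi fun _ : Fin n => D.prod D) (ghostGap W e) = (μ.prod μ) G' :=
    (measurePreserving_arrowProdEquivProdArrow Z Z (Fin n) (fun _ => D)
      (fun _ => D)).measure_preimage hG'm.nullMeasurableSet
  -- For fixed `S` the set `W S` is fixed, so Hoeffding applies to the ghost sample: with
  -- probability at least `1/2` it loses at most `n t`, leaving a gap above `n e`.
  have h2 : ∀ S ∈ B, (1 / 2 : ENNReal) ≤ μ (Prod.mk S ⁻¹' G') := fun S hS => by
    have hWS : MeasurableSet (W S) := measurable_prodMk_left hW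
    have h3 := (measure_hits_le D (n := n) hWS ht).trans hnt
    have h4 : μ.real (Prod.mk S ⁻¹' G')ᶜ ≤ 1 / 2 := by
      refine (measureReal_mono fun S' hS' => ?_).trans h3
      simp only [hG', Set.mem_compl_iff, Set.mem_preimage, Set.mem_ofPred_eq, not_lt] at hS' ⊢
      simp only [hB, Set.mem_ofPred_eq] at hS
      linarith
    rw [probReal_compl_eq_one_sub (measurable_prodMk_left hG'm)] at h4
    have h5 : (1 / 2 : ℝ) ≤ μ.real (Prod.mk S ⁻¹' G') := by linarith
    have := ENNReal.ofReal_le_of_le_toReal h5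
    rwa [ENNReal.ofReal_div_of_pos two_pos, ENNReal.ofReal_one, ENNReal.ofReal_ofNat] at this
  have h6 : (1 / 2 : ENNReal) * μ B ≤ (μ.prod μ) G' := by
    rw [Measure.prod_apply hG'm]
    calc (1 / 2 : ENNReal) * μ B = ∫⁻ _ in B, (1 / 2 : ENNReal) ∂μ := by simp
      _ ≤ ∫⁻ S in B, μ (Prod.mk S ⁻¹' G') ∂μ := setLIntegral_mono' hBm h2
      _ ≤ _ := setLIntegral_le_lintegral _ _
  have h7 := ENNReal.toReal_mono (measure_ne_top _ _) h6
  rw [← h1, ENNReal.toReal_mul] at h7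
  simp only [one_div, ENNReal.toReal_inv, ENNReal.toReal_ofNat] at h7
  simp only [measureReal_def]
  linarith

open Finset in
/-- A uniform bound on the number of swaps of a double sample that lie in `ghostGap`, when all the
selected sets cut at most `K` patterns out of the double sample. -/
lemma sum_indicator_ghostGap_le {Z : Type*} {n : ℕ} {W : (Fin n → Z) → Set Z} {e : ℝ}
    (he : 0 ≤ e) (P : Fin n → Z × Z) (𝒜 : Finset (Finset (Fin n × Bool)))
    (h𝒜 : ∀ S, ∃ A ∈ 𝒜, ∀ j : Fin n × Bool,
      j ∈ A ↔ (if j.2 then (P j.1).2 else (P j.1).1) ∈ W S) :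
    ∑ σ : Fin n → Bool, (ghostGap W e).indicator (1 : (Fin n → Z × Z) → ℝ) (swapPairs σ P) ≤
      2 ^ n * (#𝒜 * Real.exp (-(n * e ^ 2 / 2))) := by
  classical
  let a : Finset (Fin n × Bool) → Fin n → ℝ := fun A i =>
    (if (i, true) ∈ A then 1 else 0) - (if (i, false) ∈ A then 1 else 0)
  let R : Finset (Fin n × Bool) → Finset (Fin n → Bool) := fun A =>
    {σ | n * e < ∑ i, (if σ i then -a A i else a A i)}
  have hR : ∀ A, (#(R A) : ℝ) ≤ 2 ^ n * Real.exp (-(n * e ^ 2 / 2)) := fun A =>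
    card_signs_sum_gt_le (a A) (fun i => by
      by_cases h1 : (i, true) ∈ A <;> by_cases h2 : (i, false) ∈ A <;> simp [a, h1, h2]) e he
  have hsub : (univ.filter fun σ : Fin n → Bool => swapPairs σ P ∈ ghostGap W e) ⊆
      𝒜.biUnion R := fun σ hσ => by
    -- Swapping changes the selected set, but its trace on the unswapped double sample stays in `𝒜`;
    -- a union bound over traces therefore suffices, and each swap flips the sign of one difference.
    obtain ⟨A, hA, hAW⟩ := h𝒜 fun i => (swapPairs σ P i).1
    refine mem_biUnion.2 ⟨A, hA, mem_filter.2 ⟨mem_univ _, ?_⟩⟩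
    have h1 := (mem_filter.1 hσ).2
    simp only [ghostGap, Set.mem_ofPred_eq, hits, ← sum_sub_distrib] at h1
    generalize W (fun i => (swapPairs σ P i).1) = U at h1 hAW
    refine h1.trans_eq (sum_congr rfl fun i _ => ?_)
    have ht := hAW (i, true)
    have hf := hAW (i, false)
    simp only [if_true, Bool.false_eq_true, if_false] at ht hf
    simp only [a, ht, hf, Set.indicator_apply, Pi.one_apply]
    cases hσi : σ i <;> simp [swapPairs, hσi]
  calc ∑ σ : Fin n → Bool, (ghostGap W e).indicator (1 : (Fin n → Z × Z) → ℝ) (swapPairs σ P)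
      = #(univ.filter fun σ : Fin n → Bool => swapPairs σ P ∈ ghostGap W e) := by
        simp [Set.indicator_apply]
    _ ≤ ∑ A ∈ 𝒜, (#(R A) : ℝ) := by
        exact_mod_cast (card_le_card hsub).trans card_biUnion_le
    _ ≤ ∑ A ∈ 𝒜, 2 ^ n * Real.exp (-(n * e ^ 2 / 2)) := sum_le_sum fun A _ => hR A
    _ = _ := by rw [sum_const, nsmul_eq_mul]; ring

/-! ### Vapnik-Chervonenkis inequality for half-spaces. -/

/-- One-sided Vapnik-Chervonenkis inequality for a set selected by the sample among the closed
half-spaces of a feature map `φ` into `ℝ^k`. -/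
lemma measureReal_hits_halfspace_add_lt_le {Z : Type*} [MeasurableSpace Z] (D : Measure Z)
    [IsProbabilityMeasure D] {n k : ℕ} (hkn : k + 1 ≤ n) {φ : Z → Fin k → ℝ} (hφ : Measurable φ)
    {a : (Fin n → Z) → Fin k → ℝ} (ha : Measurable a) {t e : ℝ} (ht : 0 ≤ t) (he : 0 ≤ e)
    (hnt : Real.exp (-(2 * n * t ^ 2)) ≤ 1 / 2) :
    (Measure.pi fun _ : Fin n => D).real {S | hits {z | ∑ i, a S i * φ z i ≤ 0} S + n * (e + t) <
        n * D.real {z | ∑ i, a S i * φ z i ≤ 0}} ≤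
      2 * ((Real.exp 1 * (2 * n) / (k + 1)) ^ (k + 1) * Real.exp (-(n * e ^ 2 / 2))) := by
  set W : (Fin n → Z) → Set Z := fun S => {z | ∑ i, a S i * φ z i ≤ 0}
  have hW : MeasurableSet {p : (Fin n → Z) × Z | p.2 ∈ W p.1} :=
    measurableSet_le (f := fun p : (Fin n → Z) × Z => ∑ i, a p.1 i * φ p.2 i) (by fun_prop)
      measurable_const
  refine (measureReal_hits_add_lt_le_ghostGap D hW ht hnt).trans ?_
  gcongr
  refine measureReal_le_of_card_swapPairs_le D (measurableSet_ghostGap hW e) fun P => ?_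
  set ψ : Fin n × Bool → Fin k → ℝ := fun j => φ (if j.2 then (P j.1).2 else (P j.1).1)
  refine (sum_indicator_ghostGap_le he P (halfspacePatterns ψ) fun S => ?_).trans ?_
  · classical
    exact ⟨Finset.univ.filter fun j => ∑ i, a S i * ψ j i ≤ 0,
      Finset.mem_filter.2 ⟨Finset.mem_univ _, a S, by simp⟩, by simp [W, ψ]⟩
  · gcongr
    -- Using `d = k + 1` instead of `k` matches `T` and keeps `d` positive when `k = 0`.
    have := card_halfspacePatterns_le ψ (Nat.le_succ k) k.succ_pos (by simp; omega)
    simpa [mul_comm] using this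

/-- The one-sided Vapnik-Chervonenkis inequality for half-spaces whose feature map depends on an
independent variable `h`. -/
lemma prod_measureReal_hits_halfspace_add_lt_le {Z H : Type*} [MeasurableSpace Z]
    [MeasurableSpace H] (D : Measure Z) [IsProbabilityMeasure D] (ν : Measure H)
    [IsProbabilityMeasure ν] {n k : ℕ} (hkn : k + 1 ≤ n) {φ : H × Z → Fin k → ℝ}
    (hφ : Measurable φ) {a : (Fin n → Z) × H → Fin k → ℝ} (ha : Measurable a) {t e : ℝ}
    (ht : 0 ≤ t) (he : 0 ≤ e) (hnt : Real.exp (-(2 * n * t ^ 2)) ≤ 1 / 2) :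
    ((Measure.pi fun _ : Fin n => D).prod ν).real
      {ω | hits {z | ∑ i, a ω i * φ (ω.2, z) i ≤ 0} ω.1 + n * (e + t) <
        n * D.real {z | ∑ i, a ω i * φ (ω.2, z) i ≤ 0}} ≤
      2 * ((Real.exp 1 * (2 * n) / (k + 1)) ^ (k + 1) * Real.exp (-(n * e ^ 2 / 2))) := by
  set M := 2 * ((Real.exp 1 * (2 * n) / (k + 1)) ^ (k + 1) * Real.exp (-(n * e ^ 2 / 2)))
  set W : (Fin n → Z) × H → Set Z := fun ω => {z | ∑ i, a ω i * φ (ω.2, z) i ≤ 0}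
  have hW : MeasurableSet {p : ((Fin n → Z) × H) × Z | p.2 ∈ W p.1} :=
    measurableSet_le (f := fun p : ((Fin n → Z) × H) × Z => ∑ i, a p.1 i * φ (p.1.2, p.2) i)
      (by fun_prop) measurable_const
  have hB : MeasurableSet {ω | hits (W ω) ω.1 + n * (e + t) < n * D.real (W ω)} :=
    measurableSet_lt ((measurable_hits_select hW measurable_id measurable_fst).add_const _)
      ((measurable_measureReal_select D hW).const_mul _)
  have hM : 0 ≤ M := by positivity
  refine ENNReal.toReal_le_of_le_ofReal hM ?_
  rw [Measure.prod_apply_symm hB]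
  calc _ ≤ ∫⁻ _, ENNReal.ofReal M ∂ν := lintegral_mono fun h => by
        rw [ENNReal.le_ofReal_iff_toReal_le (measure_ne_top _ _) hM]
        exact measureReal_hits_halfspace_add_lt_le D hkn (φ := fun z => φ (h, z)) (by fun_prop)
          (a := fun S => a (S, h)) (by fun_prop) ht he hnt
    _ = ENNReal.ofReal M := by simp

/-! ### Size and calibration of `T`. -/

lemma log_one_div_nonneg {δ : ℝ} (hδ0 : 0 < δ) (hδ1 : δ < 1) : 0 ≤ Real.log (1 / δ) :=
  Real.log_nonneg (by rw [le_div_iff₀ hδ0]; linarith)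

lemma log_exp_one_mul_div {n k : ℕ} (hn : 0 < n) :
    Real.log (Real.exp 1 * n / ((k : ℝ) + 1)) = 1 + Real.log (n / ((k : ℝ) + 1)) := by
  have hn' : (n : ℝ) ≠ 0 := by positivity
  have hk : (k : ℝ) + 1 ≠ 0 := by positivity
  rw [mul_div_assoc, Real.log_mul (Real.exp_ne_zero _) (div_ne_zero hn' hk), Real.log_exp]

/-- With `d = k + 1`, `log x ≤ x - 1` at `x = n / d` gives `d (1 + log (n/d)) ≤ n`. This also covers
`d > n`, where a negative radicand has root `0`. -/
lemma vcTerm_le (n k : ℕ) {δ : ℝ} (hδ0 : 0 < δ) (hδ1 : δ < 1) (hn : 0 < n) :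
    vcTerm n k δ ≤ 2 * Real.sqrt (1 + Real.log (1 / δ)) := by
  have hn1 : (1 : ℝ) ≤ n := by exact_mod_cast hn
  have hl := log_one_div_nonneg hδ0 hδ1
  unfold vcTerm
  gcongr
  rw [add_div, log_exp_one_mul_div hn]
  gcongr
  · rw [div_le_one (by linarith)]
    have := Real.log_le_sub_one_of_pos (x := n / ((k : ℝ) + 1)) (by positivity)
    calc ((k : ℝ) + 1) * (1 + Real.log (n / (k + 1))) ≤ (k + 1) * (n / (k + 1)) := by
          gcongr; linarith
      _ = n := by field_simp
  · exact div_le_self hl hn1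

lemma vcTerm_nonneg (n k : ℕ) (δ : ℝ) : 0 ≤ vcTerm n k δ := by unfold vcTerm; positivity

lemma one_le_log_exp_one_mul_div {n k : ℕ} (hkn : k + 1 ≤ n) :
    1 ≤ Real.log (Real.exp 1 * n / ((k : ℝ) + 1)) := by
  rw [log_exp_one_mul_div (by omega)]
  have : (1 : ℝ) ≤ n / ((k : ℝ) + 1) := by
    rw [le_div_iff₀ (by positivity), one_mul]; exact_mod_cast hkn
  linarith [Real.log_nonneg this]

lemma mul_sq_vcTerm {n k : ℕ} {δ : ℝ} (hδ0 : 0 < δ) (hδ1 : δ < 1) (hkn : k + 1 ≤ n) :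
    n * vcTerm n k δ ^ 2 = 4 * (((k : ℝ) + 1) * Real.log (Real.exp 1 * n / ((k : ℝ) + 1)) +
      Real.log (1 / δ)) := by
  have hn : (0 : ℝ) < n := by exact_mod_cast (by omega : 0 < n)
  have hL := one_le_log_exp_one_mul_div hkn
  have hl := log_one_div_nonneg hδ0 hδ1
  rw [vcTerm, mul_pow, Real.sq_sqrt (by positivity)]
  rw [mul_left_comm, mul_div_cancel₀ _ hn.ne']
  norm_num

/-- When the bound `vcTerm` is not trivial, the sample is large compared to the dimension. -/
lemma three_le_log_of_vcTerm_lt_one {n k : ℕ} {δ : ℝ} (hδ0 : 0 < δ) (hδ1 : δ < 1)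
    (hkn : k + 1 ≤ n) (hT : vcTerm n k δ < 1) :
    3 ≤ Real.log (Real.exp 1 * n / ((k : ℝ) + 1)) := by
  have hn : (0 : ℝ) < n := by exact_mod_cast (by omega : 0 < n)
  have hk : (0 : ℝ) < (k : ℝ) + 1 := by positivity
  have hsq := mul_sq_vcTerm hδ0 hδ1 hkn
  have hl := log_one_div_nonneg hδ0 hδ1
  have hL := one_le_log_exp_one_mul_div hkn
  have hexp : n = ((k : ℝ) + 1) *
      Real.exp (Real.log (Real.exp 1 * n / ((k : ℝ) + 1)) - 1) := by
    rw [Real.exp_sub, Real.exp_log (by positivity)]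
    field_simp
  set L := Real.log (Real.exp 1 * n / ((k : ℝ) + 1))
  have hlt : 4 * L < Real.exp (L - 1) := by
    have h1 : vcTerm n k δ ^ 2 < 1 := by
      have := vcTerm_nonneg n k δ
      nlinarith
    have h2 : 4 * (((k : ℝ) + 1) * L) < (k + 1) * Real.exp (L - 1) := by
      rw [← hexp]; nlinarith
    nlinarith
  -- `4 L < exp (L - 1)` fails on `[1, 3)`: the right side is at most `e < 4` below `2`, and at most
  -- `e² < 8` from there on.
  by_contra! h3
  have he := Real.exp_one_lt_d9
  rcases le_or_gt 2 L with h2 | h2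
  · have h4 : Real.exp (L - 1) ≤ Real.exp 1 * Real.exp 1 := by
      rw [← Real.exp_add]; exact Real.exp_le_exp.2 (by linarith)
    nlinarith [Real.exp_pos 1]
  · have h4 : Real.exp (L - 1) ≤ Real.exp 1 := Real.exp_le_exp.2 (by linarith)
    linarith

/-- The deviation probability at level `vcTerm`. -/
lemma two_mul_pow_mul_exp_vcTerm_le {n k : ℕ} {δ : ℝ} (hδ0 : 0 < δ) (hδ1 : δ < 1)
    (hkn : k + 1 ≤ n) (hT : vcTerm n k δ < 1) :
    2 * ((Real.exp 1 * (2 * n) / (k + 1)) ^ (k + 1) *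
      Real.exp (-(n * (4 / 5 * vcTerm n k δ) ^ 2 / 2))) ≤ 2 * δ := by
  have hn : (0 : ℝ) < n := by exact_mod_cast (by omega : 0 < n)
  have hl := log_one_div_nonneg hδ0 hδ1
  have hL := three_le_log_of_vcTerm_lt_one hδ0 hδ1 hkn hT
  have h1 : (n : ℝ) * (4 / 5 * vcTerm n k δ) ^ 2 / 2 = 8 / 25 * (n * vcTerm n k δ ^ 2) := by ring
  have h2 : (Real.exp 1 * (2 * n) / ((k : ℝ) + 1)) ^ (k + 1) = Real.exp (((k : ℝ) + 1) *
      (Real.log 2 + Real.log (Real.exp 1 * n / ((k : ℝ) + 1)))) := by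
    rw [← Real.log_mul two_ne_zero (by positivity), ← Nat.cast_succ, Real.exp_nat_mul,
      Real.exp_log (by positivity)]
    congr 1
    ring
  have h3 : δ = Real.exp (-Real.log (1 / δ)) := by
    rw [one_div, Real.log_inv, neg_neg, Real.exp_log hδ0]
  rw [h1, mul_sq_vcTerm hδ0 hδ1 hkn, h2, ← Real.exp_add]
  conv_rhs => rw [h3]
  gcongr
  -- The exponent carries `32/25` of what is needed; the surplus `7/25 * L ≥ 21/25` exceeds the `log
  -- 2` coming from the doubled sample.
  have h4 := Real.log_two_lt_d9
  have hk : (1 : ℝ) ≤ (k : ℝ) + 1 := by linarith [k.cast_nonneg (α := ℝ)]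
  nlinarith

lemma exp_neg_vcTerm_le_half {n k : ℕ} {δ : ℝ} (hδ0 : 0 < δ) (hδ1 : δ < 1)
    (hkn : k + 1 ≤ n) (hT : vcTerm n k δ < 1) :
    Real.exp (-(2 * n * (1 / 5 * vcTerm n k δ) ^ 2)) ≤ 1 / 2 := by
  have hl := log_one_div_nonneg hδ0 hδ1
  have hL := three_le_log_of_vcTerm_lt_one hδ0 hδ1 hkn hT
  have h1 : 2 * (n : ℝ) * (1 / 5 * vcTerm n k δ) ^ 2 = 2 / 25 * (n * vcTerm n k δ ^ 2) := by ring
  have h2 : (1 / 2 : ℝ) = Real.exp (-Real.log 2) := by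
    rw [Real.exp_neg, Real.exp_log two_pos, one_div]
  rw [h1, mul_sq_vcTerm hδ0 hδ1 hkn, h2, Real.exp_le_exp]
  -- The remaining fifth of `T` gives an exponent of at least `8/25 * 3 = 24/25 > log 2`.
  have h4 := Real.log_two_lt_d9
  have hk : (1 : ℝ) ≤ (k : ℝ) + 1 := by linarith [k.cast_nonneg (α := ℝ)]
  nlinarith

/-! ### Generalization of the learned linear model. -/

/-- A label in `{-1, 1}` is mispredicted iff the margin is nonpositive. -/
lemma sign_ne_iff_mul_nonpos {u y : ℝ} (hy : y = 1 ∨ y = -1) : Real.sign u ≠ y ↔ y * u ≤ 0 := by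
  rcases lt_trichotomy u 0 with h | h | h
  · rw [Real.sign_of_neg h]
    rcases hy with rfl | rfl
    · norm_num; exact h.le
    · norm_num; exact h
  · subst h
    rcases hy with rfl | rfl <;> simp
  · rw [Real.sign_of_pos h]
    rcases hy with rfl | rfl
    · norm_num; exact h
    · norm_num; exact h.le

lemma expErr_le_one {p : ℕ} (D : Measure (Indiv p)) [IsProbabilityMeasure D] (f : Feat p) :
    expErr D f ≤ 1 := measureReal_le_one

lemma empErr_nonneg {p n : ℕ} (S : Fin n → Indiv p) (f : Feat p) : 0 ≤ empErr S f := by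
  unfold empErr; positivity

/-- Generalization bound for a linear model in the span of hypotheses that are independent of the
sample. -/
lemma one_sub_le_measureReal_expErr_le {p n k : ℕ} (D : Measure (Indiv p))
    [IsProbabilityMeasure D] (hy : ∀ᵐ z ∂D, z.2.2 = 1 ∨ z.2.2 = -1) (ν : Measure (Fin k → Feat p))
    [IsProbabilityMeasure ν] {α : (Fin n → Indiv p) × (Fin k → Feat p) → Fin k → ℝ}
    (hα : Measurable α) (hkn : k + 1 ≤ n) {δ : ℝ} (hδ0 : 0 < δ) (hδ1 : δ < 1) :
    1 - 2 * δ ≤ ((Measure.pi fun _ : Fin n => D).prod ν).real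
      {ω | expErr D (model α ω) ≤ empErr ω.1 (model α ω) + vcTerm n k δ} := by
  have hn : (0 : ℝ) < n := by exact_mod_cast (by omega : 0 < n)
  rcases le_or_gt 1 (vcTerm n k δ) with hT | hT
  · have : {ω | expErr D (model α ω) ≤ empErr ω.1 (model α ω) + vcTerm n k δ} = Set.univ :=
      Set.eq_univ_of_forall fun ω => by
        have h1 := expErr_le_one D (model α ω)
        have h2 := empErr_nonneg ω.1 (model α ω)
        rw [Set.mem_ofPred_eq]
        linarith
    rw [this, probReal_univ]
    linarith
  set μ := (Measure.pi fun _ : Fin n => D).prod ν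
  set φ : (Fin k → Feat p) × Indiv p → Fin k → ℝ :=
    fun q t => q.2.2.2 * inner ℝ (q.1 t) q.2.1 with hφ
  have hφm : Measurable φ := by fun_prop
  set W : (Fin n → Indiv p) × (Fin k → Feat p) → Set (Indiv p) :=
    fun ω => {z | ∑ t, α ω t * φ (ω.2, z) t ≤ 0} with hW
  have hWmem : ∀ ω z, (z.2.2 = 1 ∨ z.2.2 = -1) →
      (Real.sign (inner ℝ (model α ω) z.1) ≠ z.2.2 ↔ z ∈ W ω) := fun ω z hz => by
    rw [sign_ne_iff_mul_nonpos hz, hW, Set.mem_ofPred_eq, model, sum_inner, Finset.mul_sum]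
    simp only [hφ, real_inner_smul_left]
    simp only [mul_left_comm]
  have hexp : ∀ ω, expErr D (model α ω) = D.real (W ω) := fun ω =>
    measureReal_congr (by
      filter_upwards [hy] with z hz
      exact propext (hWmem ω z hz))
  have hyS : ∀ᵐ ω ∂μ, ∀ i, (ω.1 i).2.2 = 1 ∨ (ω.1 i).2.2 = -1 := by
    refine Measure.quasiMeasurePreserving_fst.ae (p := fun S : Fin n → Indiv p =>
      ∀ i, (S i).2.2 = 1 ∨ (S i).2.2 = -1) (ae_all_iff.2 fun i => ?_)
    exact (Measure.quasiMeasurePreserving_eval (fun _ : Fin n => D) i).ae hy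
  have hbad := prod_measureReal_hits_halfspace_add_lt_le D ν hkn hφm hα
    (t := 1 / 5 * vcTerm n k δ) (e := 4 / 5 * vcTerm n k δ)
    (mul_nonneg (by norm_num) (vcTerm_nonneg ..)) (mul_nonneg (by norm_num) (vcTerm_nonneg ..))
    (exp_neg_vcTerm_le_half hδ0 hδ1 hkn hT)
  replace hbad := hbad.trans (two_mul_pow_mul_exp_vcTerm_le hδ0 hδ1 hkn hT)
  set E := {ω | expErr D (model α ω) ≤ empErr ω.1 (model α ω) + vcTerm n k δ} with hE
  have hsub : μ.real Eᶜ ≤ 2 * δ := by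
    refine le_trans (ENNReal.toReal_mono (measure_ne_top _ _) (measure_mono_ae ?_)) hbad
    filter_upwards [hyS] with ω hω hωE
    have hω' : empErr ω.1 (model α ω) + vcTerm n k δ < expErr D (model α ω) :=
      lt_of_not_ge hωE
    show hits (W ω) ω.1 + _ < n * D.real (W ω)
    have hhits : hits (W ω) ω.1 = n * empErr ω.1 (model α ω) := by
      classical
      rw [empErr, mul_div_cancel₀ _ hn.ne', hits, Finset.card_filter]
      push_cast
      refine Finset.sum_congr rfl fun i _ => ?_
      simp only [hWmem ω _ (hω i), Set.indicator_apply, Pi.one_apply]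
    rw [hhits, ← hexp]
    have := mul_lt_mul_of_pos_left hω' hn
    linarith
  -- Subadditivity avoids proving `E` measurable.
  have h1 : (1 : ℝ) ≤ μ.real E + μ.real Eᶜ := by
    have := measureReal_union_le (μ := μ) E Eᶜ
    rwa [Set.union_compl_self, probReal_univ] at this
  linarith

/-! ### Exponential decay of the projection term. -/

/-- Comparison of the exponents in `projTerm`, in terms of `a = |⟨f, x⟩|` and `b = ⟨h⋆, x⟩ ^ 2`. -/
lemma exponent_le_of_decayGap {a b ε : ℝ} (ha0 : 0 ≤ a) (ha1 : a ≤ 1) (hb : 0 ≤ b) (hε : 0 ≤ ε)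
    (hgap : (b - 1 / 4) * (a + 2) ^ 2 + 1 ≤ -ε) :
    a * b / (2 * (a + 4)) - a ^ 2 / (8 * (2 + a) ^ 2) ≤ -(2 * ε ^ 2 / 225) ∧
      -(a ^ 2 / (8 * (2 + a) ^ 2)) ≤ -(2 * ε ^ 2 / 225) := by
  -- Since `b ≥ 0`, the gap forces `a (a + 4) / 4 ≥ ε`, and `a + 4 ≤ 5`.
  have haε : 4 * ε / 5 ≤ a := by nlinarith [mul_nonneg hb (sq_nonneg (a + 2))]
  have hsq : (2 + a) ^ 2 ≤ 9 := by nlinarith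
  constructor
  · have h1 : b ≤ (a * (a + 4) / 4 - ε) / (2 + a) ^ 2 := by
      rw [le_div_iff₀ (by positivity)]; nlinarith
    have h2 : a * b / (2 * (a + 4)) ≤
        a * ((a * (a + 4) / 4 - ε) / (2 + a) ^ 2) / (2 * (a + 4)) := by gcongr
    -- At the largest admissible `b`, the `ε`-free parts cancel exactly.
    have h3 : a * ((a * (a + 4) / 4 - ε) / (2 + a) ^ 2) / (2 * (a + 4)) -
        a ^ 2 / (8 * (2 + a) ^ 2) = -(a * ε / (2 * (a + 4) * (2 + a) ^ 2)) := by
      field_simp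
      ring
    have h4 : 2 * ε ^ 2 / 225 ≤ a * ε / (2 * (a + 4) * (2 + a) ^ 2) := by
      have h5 : 2 * (a + 4) * (2 + a) ^ 2 ≤ 90 := by nlinarith [sq_nonneg (2 + a)]
      calc 2 * ε ^ 2 / 225 = (4 * ε / 5) * ε / 90 := by ring
        _ ≤ a * ε / 90 := by gcongr
        _ ≤ _ := by gcongr
    linarith
  · rw [neg_le_neg_iff]
    calc 2 * ε ^ 2 / 225 = (4 * ε / 5) ^ 2 / (8 * 9) := by ring
      _ ≤ a ^ 2 / (8 * 9) := by gcongr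
      _ ≤ _ := by gcongr

/-- Substituting `c = a / (2 + a)` turns `c / (4 - 2c)` into `a / (2 (a + 4))`; the second
exponential in `g` is at most `1`. -/
lemma distG_mul_exp_le {p : ℕ} (k : ℕ) {hs f x : Feat p} (hf : ‖f‖ = 1) (hx : ‖x‖ = 1) {ε : ℝ}
    (hε : 0 ≤ ε) (hgap : decayGap hs f x ≤ -ε) :
    distG k hs f x * Real.exp (-((k : ℝ) * inner ℝ f x ^ 2 / (8 * (2 + |inner ℝ f x|) ^ 2))) ≤
      2 * Real.exp (-(2 * ε ^ 2 / 225 * k)) := by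
  have ha1 : |inner ℝ f x| ≤ 1 := by simpa [hf, hx] using abs_real_inner_le_norm f x
  obtain ⟨h1, h2⟩ := exponent_le_of_decayGap (abs_nonneg _) ha1 (sq_nonneg (inner ℝ hs x)) hε hgap
  rw [distG, distCoef, ← sq_abs (inner ℝ f x), add_mul, ← Real.exp_add, ← Real.exp_add,
    two_mul (Real.exp _)]
  have ha0 := abs_nonneg (inner ℝ f x)
  generalize |inner ℝ f x| = a at *
  generalize hb : inner ℝ hs x ^ 2 = b at *
  have hb0 : 0 ≤ b := hb ▸ sq_nonneg _
  have hk : (0 : ℝ) ≤ k := k.cast_nonneg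
  have hden : 4 - 2 * (a / (2 + a)) = 2 * (a + 4) / (2 + a) := by field_simp; ring
  refine add_le_add (Real.exp_le_exp.2 ?_) (Real.exp_le_exp.2 ?_)
  · calc _ = k * (a * b / (2 * (a + 4)) - a ^ 2 / (8 * (2 + a) ^ 2)) := by
          rw [hden]; field_simp; ring
      _ ≤ k * -(2 * ε ^ 2 / 225) := by gcongr
      _ = _ := by ring
  · calc _ ≤ k * -(a ^ 2 / (8 * (2 + a) ^ 2)) := by
          have : 0 ≤ a / (2 + a) * k * b / (2 + 2 * (a / (2 + a))) := by positivity
          have h3 : k * -(a ^ 2 / (8 * (2 + a) ^ 2)) = -(k * a ^ 2 / (8 * (2 + a) ^ 2)) := by ring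
          linarith
      _ ≤ k * -(2 * ε ^ 2 / 225) := by gcongr
      _ = _ := by ring

lemma projTerm_le {p n : ℕ} (k : ℕ) {δ : ℝ} (hδ0 : 0 < δ) {hs f : Feat p} {x : Fin n → Feat p}
    (hn : 0 < n) (hf : ‖f‖ = 1) (hx : ∀ i, ‖x i‖ = 1) {ε : ℝ} (hε : 0 ≤ ε)
    (hgap : ∀ i, decayGap hs f (x i) ≤ -ε) :
    projTerm k δ hs f x ≤ 8 / δ * Real.exp (-(2 * ε ^ 2 / 225 * k)) := by
  have hn' : (0 : ℝ) < n := by exact_mod_cast hn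
  calc projTerm k δ hs f x
      ≤ 4 / (n * δ) * ∑ _ : Fin n, 2 * Real.exp (-(2 * ε ^ 2 / 225 * k)) := by
        unfold projTerm
        gcongr ?_ * ?_
        exact Finset.sum_le_sum fun i _ => distG_mul_exp_le k hf (hx i) hε (hgap i)
    _ = _ := by
        simp only [Finset.sum_const, Finset.card_univ, Fintype.card_fin, nsmul_eq_mul]
        field_simp
        norm_num

lemma projTerm_nonneg {p n : ℕ} (k : ℕ) {δ : ℝ} (hδ0 : 0 < δ) (hs f : Feat p)
    (x : Fin n → Feat p) : 0 ≤ projTerm k δ hs f x := by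
  unfold projTerm distG; positivity

end FairLearning

/-! ### Assembly of the two halves. -/

open FairLearning in
theorem mainTheorem7 (δ : ℝ) (hδ0 : 0 < δ) (hδ1 : δ < 1) :
    ∃ (c₁ c₂ C : ℝ) (r : ℝ → ℝ),
      0 < c₁ ∧ 0 < c₂ ∧ 0 < C ∧ (∀ ε : ℝ, 0 < ε → 0 < r ε) ∧
      -- the error bound `T + projTerm` itself
      (∀ (p n k : ℕ) (hs f : Feat p) (x : Fin n → Feat p),
        0 < n → ‖f‖ = 1 → (∀ i, ‖x i‖ = 1) →
          vcTerm n k δ ≤ c₁ ∧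
          ((∀ i, decayGap hs f (x i) ≤ 0) →
            vcTerm n k δ + projTerm k δ hs f x ≤ c₁ + C * Real.exp (-(c₂ * k))) ∧
          (∀ ε : ℝ, 0 < ε → (∀ i, decayGap hs f (x i) ≤ -ε) →
            projTerm k δ hs f x ≤ C * Real.exp (-(r ε * k)))) ∧
      -- the generalization error of the learned model
      (∀ (p n k : ℕ) (D : Measure (Indiv p)) (hs : Feat p)
        (α : (Fin n → Indiv p) × (Fin k → Feat p) → Fin k → ℝ),
        IsProbabilityMeasure D → (∀ᵐ z ∂D, ‖z.1‖ = 1) → (∀ᵐ z ∂D, z.2.2 = 1 ∨ z.2.2 = -1) →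
        covariance (fun z : Indiv p => inner ℝ hs z.1) (fun z : Indiv p => z.2.1) D = 0 →
        Measurable α → k + 1 ≤ n →
          1 - 4 * δ ≤ (softLaw D hs n k).real {ω | ‖model α ω‖ = 1 →
            expErr D (model α ω) ≤ empErr ω.1 (model α ω) + vcTerm n k δ +
              projTerm k δ hs (model α ω) (fun i => (ω.1 i).1) ∧
            ((∀ i, decayGap hs (model α ω) (ω.1 i).1 ≤ 0) →
              expErr D (model α ω) ≤ empErr ω.1 (model α ω) +
                c₁ + C * Real.exp (-(c₂ * k))) ∧
            (∀ ε : ℝ, 0 < ε → (∀ i, decayGap hs (model α ω) (ω.1 i).1 ≤ -ε) →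
              expErr D (model α ω) ≤ empErr ω.1 (model α ω) +
                vcTerm n k δ + C * Real.exp (-(r ε * k)))}) := by
  have hl := log_one_div_nonneg hδ0 hδ1
  -- With `Q ≤ 0` only (`ε = 0`), the projection term is bounded by `8 / δ`, which `c₁` absorbs;
  -- hence `c₂ = 1` is an arbitrary choice.
  refine ⟨2 * Real.sqrt (1 + Real.log (1 / δ)) + 8 / δ, 1, 8 / δ, fun ε => 2 * ε ^ 2 / 225,
    by positivity, one_pos, by positivity, fun ε hε => by positivity, ?_, ?_⟩
  · intro p n k hs f x hn hf hx
    have hT := vcTerm_le n k hδ0 hδ1 hn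
    have hδ8 : 0 < 8 / δ := by positivity
    refine ⟨by linarith, fun hgap => ?_, fun ε hε hgap => projTerm_le k hδ0 hn hf hx hε.le hgap⟩
    have hP := projTerm_le k hδ0 hn hf hx le_rfl (by simpa using hgap)
    have hC : 0 ≤ 8 / δ * Real.exp (-(1 * k)) := by positivity
    simp only [ne_eq, OfNat.ofNat_ne_zero, not_false_eq_true, zero_pow, mul_zero, zero_div,
      zero_mul, neg_zero, Real.exp_zero, mul_one] at hP
    linarith
  · intro p n k D hs α hD _ hy _ hα hkn
    have hT := vcTerm_le n k hδ0 hδ1 (by omega : 0 < n)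
    have hδ8 : 0 < 8 / δ := by positivity
    have hmain := one_sub_le_measureReal_expErr_le D hy
      (Measure.pi fun _ : Fin k => multivariateGaussian hs (1 : Matrix (Fin p) (Fin p) ℝ))
      hα hkn hδ0 hδ1
    refine le_trans (by linarith) (hmain.trans (measureReal_mono ?_ (measure_ne_top _ _)))
    intro ω hω _
    replace hω : expErr D (model α ω) ≤ empErr ω.1 (model α ω) + vcTerm n k δ := hω
    refine ⟨?_, fun _ => ?_, fun ε _ _ => ?_⟩
    · linarith [projTerm_nonneg k hδ0 hs (model α ω) fun i => (ω.1 i).1]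
    · have hC : 0 ≤ 8 / δ * Real.exp (-(1 * k)) := by positivity
      linarith
    · have hC : 0 ≤ 8 / δ * Real.exp (-(2 * ε ^ 2 / 225 * k)) := by positivity
      linarith
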